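/- Let $K$ be a number field with ring of integers $\mathfrak o$, class number $h_K=1$ and at most one real place. Let $\mathbb A_f$ be the ring of finite adeles of $K$, let $K_\infty=\prod_{\nu\mid\infty}K_\nu$ be the product of the completions at the infinite places, and let $\mathbb A^*$ be the idele group, i.e. the unit group of $\mathbb A=K_\infty\times\mathbb A_f$ with its usual restricted product topology. Put $\hat{\mathfrak o}^*=\prod_{\nu\nmid\infty}\mathfrak o_\nu^*$, regarded as a subgroup of $\mathbb A^*$ by inserting $1$ at the infinite places. Let $K_{\infty,+}^\times$ be the connected component of the identity in $K_\infty^\times$ (embedded in $\mathbb A^*$ with $1$ at the finite places), embed $K^\times$ diagonally in $\mathbb A^*$, and let $U=\overline{K^\times K_{\infty,+}^\times}$ be the closure in $\mathbb A^*$. Let $\mathbb A_f/\!\sim_{\hat{\mathfrak o}^*\cap U}$ be the quotient space of $\mathbb A_f$ by the relation: $y\sim\tilde y$ if and only if $y=z\tilde y$ for some $z\in\hat{\mathfrak o}^*\cap U$. Let $\mathbb A^*/U\times_{\hat{\mathfrak o}^*}\mathbb A_f$ be the quotient space of $\mathbb A^*/U\times\mathbb A_f$ by the relation: $(x,y)\sim(x',y')$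 if and only if $(rx,r^{-1}y)=(x',y')$ for some $r\in\hat{\mathfrak o}^*$. Both carry the quotient topology, and $(\cdot)^\bullet$ denotes classes. Then the well-defined map $$\varphi^*:\ \mathbb A_f/\!\sim_{\hat{\mathfrak o}^*\cap U}\ \longrightarrow\ \mathbb A^*/U\times_{\hat{\mathfrak o}^*}\mathbb A_f,\qquad y^\bullet\longmapsto\big((1)^\bullet,y\big)^\bullet,$$ is a homeomorphism. -/

import Mathlib

open NumberField IsDedekindDomain
open scoped NumberField.AdeleRing

namespace AdelicQuotient

noncomputable section

variable (K : Type*) [Field K] [NumberField K]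

/-- The idele group `𝔸*`: the units of the adele ring `𝔸 = K∞ × 𝔸_f`, with the unit-group topology
(which is the restricted product topology). -/
abbrev Ideles : Type _ := (𝔸[K])ˣ

/-- The embedding `K∞ˣ → 𝔸*`, with `1` at all finite places. -/
def infToIdeles : (K∞)ˣ →* Ideles K :=
  Units.map
    { toFun := fun x => ((x, 1) : K∞ × 𝔸ᶠ[K])
      map_one' := rfl
      map_mul' := fun _ _ => Prod.ext rfl (one_mul (1 : 𝔸ᶠ[K])).symm : K∞ →* 𝔸[K] }

/-- The embedding `𝔸_fˣ → 𝔸*`, with `1` at all infinite places. -/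
def finToIdeles : (𝔸ᶠ[K])ˣ →* Ideles K :=
  Units.map
    { toFun := fun y => ((1, y) : K∞ × 𝔸ᶠ[K])
      map_one' := rfl
      map_mul' := fun _ _ => Prod.ext (one_mul (1 : K∞)).symm rfl : 𝔸ᶠ[K] →* 𝔸[K] }

/-- The principal ideles: `Kˣ` embedded diagonally in `𝔸*`. -/
def principalIdeles : Subgroup (Ideles K) :=
  (Units.map (algebraMap K 𝔸[K] : K →* 𝔸[K])).range

/-- `K_{∞,+}ˣ`: the connected component of the identity of `K∞ˣ`, as a subgroup of `𝔸*`. -/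
def infPos : Subgroup (Ideles K) :=
  (Subgroup.connectedComponentOfOne (K∞)ˣ).map (infToIdeles K)

/-- `U`: the closure in `𝔸*` of the product of the subgroups `Kˣ` and `K_{∞,+}ˣ`. -/
def U : Subgroup (Ideles K) :=
  (principalIdeles K ⊔ infPos K).topologicalClosure

instance : (U K).Normal := inferInstance

/-- `ô* = ∏_v o_v*` (over the finite places `v`) as a group of finite ideles: `o_v*` consists of
the elements of `K_v` of valuation one. -/
def integralUnits : Subgroup (𝔸ᶠ[K])ˣ where
  carrier := {u | ∀ v : HeightOneSpectrum (𝓞 K), Valued.v ((u : 𝔸ᶠ[K]) v) = 1}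
  one_mem' := fun v => map_one (Valued.v (R := v.adicCompletion K))
  mul_mem' := by
    intro a b ha hb v
    have h : ((a * b : (𝔸ᶠ[K])ˣ) : 𝔸ᶠ[K]) v = (a : 𝔸ᶠ[K]) v * (b : 𝔸ᶠ[K]) v := rfl
    rw [h, map_mul, ha v, hb v, one_mul]
  inv_mem' := by
    intro a ha v
    have h : (a : 𝔸ᶠ[K]) v * ((a⁻¹ : (𝔸ᶠ[K])ˣ) : 𝔸ᶠ[K]) v = 1 :=
      congrArg (fun x : 𝔸ᶠ[K] => x v) a.mul_inv
    have h' := congrArg Valued.v h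
    rwa [map_mul, ha v, one_mul, map_one] at h'

/-- `ô* ∩ U`, as a group of finite ideles. -/
def integralUnitsInU : Subgroup (𝔸ᶠ[K])ˣ :=
  integralUnits K ⊓ (U K).comap (finToIdeles K)

/-- The relation `y ∼ y'` on `𝔸_f`: there is `z ∈ ô* ∩ U` with `y = z y'`. -/
def finSetoid : Setoid 𝔸ᶠ[K] where
  r y y' := ∃ z ∈ integralUnitsInU K, y = (z : 𝔸ᶠ[K]) * y'
  iseqv :=
    { refl := fun y => ⟨1, one_mem _, by simp⟩
      symm := by
        rintro y y' ⟨z, hz, rfl⟩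
        exact ⟨z⁻¹, inv_mem hz, by simp⟩
      trans := by
        rintro y y' y'' ⟨z, hz, rfl⟩ ⟨w, hw, rfl⟩
        exact ⟨z * w, mul_mem hz hw, by simp [mul_assoc]⟩ }

/-- The relation on `𝔸*/U × 𝔸_f`: `(x, y) ∼ (x', y')` if there is `r ∈ ô*` with
`(r x, r⁻¹ y) = (x', y')`. -/
def balancedSetoid : Setoid ((Ideles K ⧸ U K) × 𝔸ᶠ[K]) where
  r p q := ∃ r ∈ integralUnits K,
    ((finToIdeles K r : Ideles K ⧸ U K) * p.1, ((r⁻¹ : (𝔸ᶠ[K])ˣ) : 𝔸ᶠ[K]) * p.2) = q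
  iseqv :=
    { refl := fun p => ⟨1, one_mem _, by simp⟩
      symm := by
        rintro p q ⟨r, hr, rfl⟩
        exact ⟨r⁻¹, inv_mem hr, by simp⟩
      trans := by
        rintro p q s ⟨r, hr, rfl⟩ ⟨t, ht, rfl⟩
        exact ⟨t * r, mul_mem ht hr, by simp [mul_assoc, mul_left_comm]⟩ }

/-- The quotient space `𝔸_f / ∼_{ô* ∩ U}`, with the quotient topology. -/
abbrev FinQuotient : Type _ := Quotient (finSetoid K)

/-- The space `𝔸*/U ×_{ô*} 𝔸_f`, with the quotient topology of the product topology. -/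
abbrev BalancedProduct : Type _ := Quotient (balancedSetoid K)

/-- The map `φ*` sending the class of `y` to the class of `(1, y)`. -/
def phiStar : FinQuotient K → BalancedProduct K :=
  Quotient.map (sa := finSetoid K) (sb := balancedSetoid K) (fun y => (1, y)) (by
    rintro y y' ⟨z, hz, rfl⟩
    refine ⟨z, hz.1, Prod.ext ?_ (by simp)⟩
    have h : (finToIdeles K z : Ideles K ⧸ U K) = 1 := (QuotientGroup.eq_one_iff _).2 hz.2
    simp [h])

end

end AdelicQuotient

namespace AdelicQuotient

/-! ### Finite ideles when the class number is one -/

section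

variable (K : Type*) [Field K] [NumberField K]

/-! The key fact is 𝔸* = ô*·U (`exists_idele_eq`): class number one splits a finite idele into a
principal one times an element of ô*, and with at most one real place the sign -1 ∈ Kˣ moves the
infinite part into the identity component. So ô* → 𝔸*/U is onto. It is also open, since ô* and the
identity component of K∞ˣ are open and the latter lies in U. Hence ô* × 𝔸_f → 𝔸*/U × 𝔸_f is an open
quotient map. Along it, the image under φ* of an open set O pulls back to {(r, y) | (ry)^• ∈ O},
which is open. Injectivity is formal. -/

theorem exists_uniformizer_of_isPrincipalIdealRing {R F : Type*} [CommRing R] [IsDedekindDomain R]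
    [IsPrincipalIdealRing R] [Field F] [Algebra R F] [IsFractionRing R F]
    (v : HeightOneSpectrum R) :
    ∃ p : Fˣ, v.valuation F p = WithZero.exp (-1) ∧ ∀ w ≠ v, w.valuation F (p : F) = 1 := by
  obtain ⟨p, hp⟩ := (IsPrincipalIdealRing.principal v.asIdeal).principal
  replace hp : v.asIdeal = Ideal.span {p} := hp
  have hp0 : p ≠ 0 := by
    rintro rfl
    exact v.ne_bot (by simpa using hp)
  refine ⟨Units.mk0 (algebraMap R F p) (by simpa using hp0), ?_, fun w hw ↦ ?_⟩
  · rw [Units.val_mk0, v.valuation_of_algebraMap, v.intValuation_singleton hp0 hp]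
  · rw [Units.val_mk0, w.valuation_of_algebraMap, w.intValuation_eq_one_iff]
    intro hmem
    refine hw (HeightOneSpectrum.ext (v.isMaximal.eq_of_le w.isPrime.ne_top ?_).symm)
    rw [hp]
    simpa [Ideal.span_singleton_le_iff_mem] using hmem

theorem exists_valuation_eq_exp {R F : Type*} [CommRing R] [IsDedekindDomain R]
    [IsPrincipalIdealRing R] [Field F] [Algebra R F] [IsFractionRing R F]
    (n : HeightOneSpectrum R → ℤ) (hn : n.support.Finite) :
    ∃ k : Fˣ, ∀ v : HeightOneSpectrum R, v.valuation F (k : F) = WithZero.exp (n v) := by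
  classical
  choose p hp hp' using fun v : HeightOneSpectrum R ↦
    exists_uniformizer_of_isPrincipalIdealRing (F := F) v
  -- The sign appears because a uniformizer has valuation `exp (-1)`.
  refine ⟨∏ w ∈ hn.toFinset, p w ^ (-n w), fun v ↦ ?_⟩
  rw [Units.coe_prod, map_prod, Finset.prod_eq_single v]
  · simp [hp, ← WithZero.exp_zsmul]
  · intro w _ hw
    simp [hp' w v hw.symm]
  · intro hv
    simp_all

variable {K} in
theorem finiteAdele_mul_apply (x y : 𝔸ᶠ[K]) (v : HeightOneSpectrum (𝓞 K)) :
    (x * y) v = x v * y v := rfl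

variable {K} in
theorem valued_mul_valued_inv (u : (𝔸ᶠ[K])ˣ) (v : HeightOneSpectrum (𝓞 K)) :
    Valued.v ((u : 𝔸ᶠ[K]) v) * Valued.v (((u⁻¹ : (𝔸ᶠ[K])ˣ) : 𝔸ᶠ[K]) v) = 1 := by
  rw [← map_mul, ← finiteAdele_mul_apply, Units.mul_inv]
  exact map_one (Valued.v (R := v.adicCompletion K))

theorem exists_unitEmbedding_mul_mem (h : classNumber K = 1) (a : (𝔸ᶠ[K])ˣ) :
    ∃ k : Kˣ, ∃ r ∈ integralUnits K, a = FiniteAdeleRing.unitEmbedding (𝓞 K) K k * r := by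
  have := (classNumber_eq_one_iff (K := K)).1 h
  obtain ⟨ha0, ha⟩ := FiniteAdeleRing.isUnit_iff.1 a.isUnit
  obtain ⟨k, hk⟩ := exists_valuation_eq_exp (F := K)
    (fun v : HeightOneSpectrum (𝓞 K) ↦ WithZero.log (Valued.v ((a : 𝔸ᶠ[K]) v))) (by
      refine Set.Finite.subset ha fun v hv ↦ ?_
      contrapose! hv
      simp_all)
  refine ⟨k, (FiniteAdeleRing.unitEmbedding (𝓞 K) K k)⁻¹ * a, fun v ↦ ?_, by simp⟩
  have h : Valued.v ((a : 𝔸ᶠ[K]) v) = Valued.v (((k : K) : v.adicCompletion K)) *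
      Valued.v ((((FiniteAdeleRing.unitEmbedding (𝓞 K) K k)⁻¹ * a : (𝔸ᶠ[K])ˣ) : 𝔸ᶠ[K]) v) := by
    rw [← map_mul, ← FiniteAdeleRing.algebraMap_apply, ← finiteAdele_mul_apply,
      ← FiniteAdeleRing.unitEmbedding_apply, ← Units.val_mul, mul_inv_cancel_left]
  rw [HeightOneSpectrum.valuedAdicCompletion_eq_valuation', hk, WithZero.exp_log
    ((Valuation.ne_zero_iff _).2 (ha0 v))] at h
  exact (mul_eq_left₀ ((Valuation.ne_zero_iff _).2 (ha0 v))).1 h.symm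

/-- A finite idele lies in ô* exactly when it and its inverse are integral everywhere, and both
conditions are open in the unit topology. -/
theorem isOpen_integralUnits : IsOpen (integralUnits K : Set (𝔸ᶠ[K])ˣ) := by
  have hO : IsOpen {x : 𝔸ᶠ[K] | ∀ v, x v ∈ v.adicCompletionIntegers K} :=
    RestrictedProduct.isOpen_forall_mem fun v ↦ Valued.isOpen_valuationSubring _
  convert (hO.preimage Units.continuous_val).inter (hO.preimage Units.continuous_coe_inv)
  ext u
  refine ⟨fun hu ↦ ⟨fun v ↦ (hu v).le, fun v ↦ (inv_mem hu v).le⟩, fun hu v ↦ ?_⟩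
  have h := valued_mul_valued_inv u v
  exact le_antisymm (hu.1 v) (h ▸ mul_le_of_le_one_right' (hu.2 v))

end

/-! ### The identity component of K∞ˣ -/

section

variable {K : Type*} [Field K]

/-- The units of the completion at an infinite place that are positive if the place is real. -/
def positiveUnits (v : InfinitePlace K) : Set (v.Completion)ˣ :=
  {u | ∀ hv : v.IsReal, 0 < InfinitePlace.Completion.extensionEmbeddingOfIsReal hv u}

theorem isOpen_positiveUnits (v : InfinitePlace K) : IsOpen (positiveUnits v) := by
  refine isOpen_iff_forall_mem_open.2 fun u hu ↦ ?_
  by_cases hv : v.IsReal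
  · refine ⟨_, fun w hw _ ↦ hw, isOpen_Ioi.preimage
      ((InfinitePlace.Completion.isometry_extensionEmbeddingOfIsReal hv).continuous.comp
        Units.continuous_val), hu hv⟩
  · exact ⟨Set.univ, fun w _ h ↦ absurd h hv, isOpen_univ, trivial⟩

/-- The embedding into ℝ or ℂ induces the topology, and the image is (0, ∞) or ℂ ∖ {0}. -/
theorem isPreconnected_positiveUnits (v : InfinitePlace K) : IsPreconnected (positiveUnits v) := by
  by_cases hv : v.IsReal
  · have hi := (InfinitePlace.Completion.isometry_extensionEmbeddingOfIsReal hv).isUniformInducing.isInducing.comp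
      (Units.isEmbedding_val₀ (G₀ := v.Completion)).isInducing
    rw [← hi.isPreconnected_image]
    convert isPreconnected_Ioi (a := (0 : ℝ))
    ext x
    refine ⟨?_, fun hx ↦ ?_⟩
    · rintro ⟨u, hu, rfl⟩
      exact hu hv
    · obtain ⟨y, rfl⟩ := InfinitePlace.Completion.surjective_extensionEmbeddingOfIsReal hv x
      exact ⟨Units.mk0 y fun h ↦ by simp [h] at hx, fun _ ↦ hx, rfl⟩
  · have hi := (InfinitePlace.Completion.isometry_extensionEmbedding v).isUniformInducing.isInducing.comp
      (Units.isEmbedding_val₀ (G₀ := v.Completion)).isInducing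
    rw [← hi.isPreconnected_image]
    convert (isConnected_compl_singleton_of_one_lt_rank (E := ℂ)
      (by simp [Complex.rank_real_complex]) 0).isPreconnected
    ext x
    refine ⟨?_, fun hx ↦ ?_⟩
    · rintro ⟨u, hu, rfl⟩
      simp
    · obtain ⟨y, rfl⟩ := InfinitePlace.Completion.surjective_extensionEmbedding_of_isComplex
        (InfinitePlace.not_isReal_iff_isComplex.1 hv) x
      exact ⟨Units.mk0 y fun h ↦ by simp [h] at hx, fun h ↦ absurd h hv, rfl⟩

variable (K)

/-- The units of `K∞` that are positive at every real place. -/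
def totallyPositiveUnits : Set (K∞)ˣ :=
  (ContinuousMulEquiv.piUnits (M := fun v : InfinitePlace K ↦ v.Completion)) ⁻¹'
    Set.univ.pi positiveUnits

theorem one_mem_totallyPositiveUnits : 1 ∈ totallyPositiveUnits K := fun v _ hv ↦ by
  change 0 < InfinitePlace.Completion.extensionEmbeddingOfIsReal hv (1 : v.Completion)
  rw [map_one]
  exact one_pos

/-- This inclusion suffices: it makes the identity component a neighbourhood of 1, hence open. -/
theorem totallyPositiveUnits_subset :
    totallyPositiveUnits K ⊆ Subgroup.connectedComponentOfOne (K∞)ˣ := by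
  refine IsPreconnected.subset_connectedComponent ?_ (one_mem_totallyPositiveUnits K)
  exact (ContinuousMulEquiv.piUnits
    (M := fun v : InfinitePlace K ↦ v.Completion)).toHomeomorph.isPreconnected_preimage.2
      (isPreconnected_univ_pi isPreconnected_positiveUnits)

variable [NumberField K]

theorem isOpen_totallyPositiveUnits : IsOpen (totallyPositiveUnits K) :=
  (isOpen_set_pi Set.finite_univ fun v _ ↦ isOpen_positiveUnits v).preimage
    (ContinuousMulEquiv.piUnits (M := fun v : InfinitePlace K ↦ v.Completion)).continuous

theorem isOpen_connectedComponentOfOne :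
    IsOpen (Subgroup.connectedComponentOfOne (K∞)ˣ : Set (K∞)ˣ) :=
  Subgroup.isOpen_of_mem_nhds _ (g := 1) <| Filter.mem_of_superset
    ((isOpen_totallyPositiveUnits K).mem_nhds (one_mem_totallyPositiveUnits K))
    (totallyPositiveUnits_subset K)

theorem mem_or_neg_mem_connectedComponentOfOne (h : InfinitePlace.nrRealPlaces K ≤ 1)
    (x : (K∞)ˣ) :
    x ∈ Subgroup.connectedComponentOfOne (K∞)ˣ ∨ -x ∈ Subgroup.connectedComponentOfOne (K∞)ˣ := by
  classical
  have hs := Fintype.card_le_one_iff_subsingleton.1 h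
  by_cases hx : x ∈ totallyPositiveUnits K
  · exact .inl (totallyPositiveUnits_subset K hx)
  refine .inr (totallyPositiveUnits_subset K fun v _ hv ↦ ?_)
  -- Positivity at the only real place would make `x` totally positive.
  have hneg : ¬ 0 < InfinitePlace.Completion.extensionEmbeddingOfIsReal hv ((x : K∞) v) := by
    refine fun h0 ↦ hx fun w _ hw ↦ ?_
    obtain rfl : w = v := congrArg Subtype.val (Subsingleton.elim (α := {w // _}) ⟨w, hw⟩ ⟨v, hv⟩)
    exact h0
  have hne : InfinitePlace.Completion.extensionEmbeddingOfIsReal hv ((x : K∞) v) ≠ 0 := by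
    have : (x : K∞) v * ((x⁻¹ : (K∞)ˣ) : K∞) v = 1 := congrArg (fun y : K∞ ↦ y v) x.mul_inv
    simpa using left_ne_zero_of_mul_eq_one this
  change 0 < InfinitePlace.Completion.extensionEmbeddingOfIsReal hv (-((x : K∞) v))
  rw [map_neg]
  exact neg_pos.2 (lt_of_le_of_ne (not_lt.1 hneg) hne)

end

/-! ### Decomposition of ideles and the homeomorphism -/

section

variable (K : Type*) [Field K] [NumberField K]

theorem exists_idele_eq (hclass : classNumber K = 1) (hreal : InfinitePlace.nrRealPlaces K ≤ 1)
    (x : Ideles K) : ∃ r ∈ integralUnits K, ∃ u ∈ U K, x = finToIdeles K r * u := by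
  obtain ⟨⟨x₁, x₂⟩, rfl⟩ := (MulEquiv.prodUnits (M := K∞) (N := 𝔸ᶠ[K])).symm.surjective x
  obtain ⟨k₀, r₀, hr₀, rfl⟩ := exists_unitEmbedding_mul_mem K hclass x₂
  obtain ⟨k, r, hr, hkr, hc⟩ : ∃ k : Kˣ, ∃ r ∈ integralUnits K,
      FiniteAdeleRing.unitEmbedding (𝓞 K) K k₀ * r₀ =
        r * FiniteAdeleRing.unitEmbedding (𝓞 K) K k ∧
      (Units.map (algebraMap K K∞ : K →* K∞) k)⁻¹ * x₁ ∈
        Subgroup.connectedComponentOfOne (K∞)ˣ := by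
    rcases mem_or_neg_mem_connectedComponentOfOne K hreal
      ((Units.map (algebraMap K K∞ : K →* K∞) k₀)⁻¹ * x₁) with h | h
    · exact ⟨k₀, r₀, hr₀, mul_comm _ _, h⟩
    -- Changing both signs keeps the finite product and negates the infinite quotient.
    · refine ⟨-k₀, -r₀, fun v ↦ (Valuation.map_neg _ _).trans (hr₀ v), ?_, ?_⟩
      · ext1
        simp [mul_comm]
      · convert h using 1
        rw [← neg_mul, ← inv_neg]
        congr 2
        ext1
        simp
  have hU : Units.map (algebraMap K 𝔸[K] : K →* 𝔸[K]) k *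
      infToIdeles K ((Units.map (algebraMap K K∞ : K →* K∞) k)⁻¹ * x₁) ∈ U K :=
    Subgroup.le_topologicalClosure _ <| mul_mem (Subgroup.mem_sup_left ⟨k, rfl⟩)
      (Subgroup.mem_sup_right (Subgroup.mem_map_of_mem _ hc))
  refine ⟨r, hr, _, hU, ?_⟩
  rw [hkr]
  refine Units.ext (Prod.ext ?_ ?_)
  · change (x₁ : K∞) = 1 * ((Units.map (algebraMap K K∞ : K →* K∞) k : (K∞)ˣ) *
      (((Units.map (algebraMap K K∞ : K →* K∞) k)⁻¹ * x₁ : (K∞)ˣ) : K∞))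
    rw [one_mul, ← Units.val_mul, mul_inv_cancel_left]
  · change (r : 𝔸ᶠ[K]) * algebraMap K 𝔸ᶠ[K] k = r * (algebraMap K 𝔸ᶠ[K] k * 1)
    rw [mul_one]

theorem continuous_finToIdeles : Continuous (finToIdeles K) :=
  Continuous.units_map _ (Continuous.prodMk continuous_const continuous_id)

theorem isOpenMap_integralUnits_quotient :
    IsOpenMap fun r : integralUnits K ↦ (finToIdeles K r : Ideles K ⧸ U K) := by
  intro V hV
  have hV' := (isOpen_integralUnits K).isOpenMap_subtype_val V hV
  -- Thickening `V` by the identity component gives an open set of ideles with the same image modulo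
  -- U.
  have hO := (Homeomorph.prodUnits (α := K∞) (β := 𝔸ᶠ[K])).symm.isOpenMap _
    ((isOpen_connectedComponentOfOne K).prod hV')
  convert QuotientGroup.isOpenMap_coe (N := U K) _ hO
  ext p
  constructor
  · rintro ⟨r, hr, rfl⟩
    exact ⟨_, ⟨(1, r), ⟨one_mem (Subgroup.connectedComponentOfOne (K∞)ˣ), ⟨r, hr, rfl⟩⟩, rfl⟩, rfl⟩
  · rintro ⟨_, ⟨⟨c, _⟩, ⟨hc, ⟨r, hr, rfl⟩⟩, rfl⟩, rfl⟩
    refine ⟨r, hr, QuotientGroup.eq.2 ?_⟩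
    have hc' : infToIdeles K c ∈ U K := Subgroup.le_topologicalClosure _
      (Subgroup.mem_sup_right (Subgroup.mem_map_of_mem _ hc))
    convert hc'
    refine inv_mul_eq_iff_eq_mul.2 (Units.ext (Prod.ext ?_ ?_))
    · exact (one_mul (c : K∞)).symm
    · exact (mul_one ((r : (𝔸ᶠ[K])ˣ) : 𝔸ᶠ[K])).symm

variable {K}

theorem isOpenQuotientMap_integralUnits_quotient (hclass : classNumber K = 1)
    (hreal : InfinitePlace.nrRealPlaces K ≤ 1) :
    IsOpenQuotientMap fun r : integralUnits K ↦ (finToIdeles K r : Ideles K ⧸ U K) where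
  surjective p := by
    obtain ⟨x, rfl⟩ := QuotientGroup.mk_surjective p
    obtain ⟨r, hr, u, hu, rfl⟩ := exists_idele_eq K hclass hreal x
    exact ⟨⟨r, hr⟩, QuotientGroup.eq.2 (by simpa using hu)⟩
  continuous := QuotientGroup.continuous_mk.comp
    ((continuous_finToIdeles K).comp continuous_subtype_val)
  isOpenMap := isOpenMap_integralUnits_quotient K

theorem phiStar_mk_mul {r : (𝔸ᶠ[K])ˣ} (hr : r ∈ integralUnits K) (y : 𝔸ᶠ[K]) :
    phiStar K (Quotient.mk (finSetoid K) (r * y)) =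
      Quotient.mk (balancedSetoid K) ((finToIdeles K r : Ideles K ⧸ U K), y) :=
  Quotient.sound ⟨r, hr, by simp⟩

variable (K) in
theorem continuous_phiStar : Continuous (phiStar K) :=
  continuous_quot_lift _ (continuous_quot_mk.comp (Continuous.prodMk continuous_const continuous_id))

variable (K) in
theorem injective_phiStar : Function.Injective (phiStar K) := by
  rintro ⟨y⟩ ⟨y'⟩ h
  obtain ⟨r, hr, h⟩ := Quotient.exact h
  obtain ⟨h₁, h₂⟩ := Prod.ext_iff.1 h
  refine Quotient.sound ⟨r, ⟨hr, (QuotientGroup.eq_one_iff _).1 (by simpa using h₁)⟩, ?_⟩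
  exact (Units.inv_mul_eq_iff_eq_mul r).1 h₂

theorem surjective_phiStar (hclass : classNumber K = 1)
    (hreal : InfinitePlace.nrRealPlaces K ≤ 1) : Function.Surjective (phiStar K) := by
  rintro ⟨p, y⟩
  obtain ⟨r, rfl⟩ := (isOpenQuotientMap_integralUnits_quotient hclass hreal).surjective p
  exact ⟨_, phiStar_mk_mul r.2 y⟩

theorem isOpenMap_phiStar (hclass : classNumber K = 1)
    (hreal : InfinitePlace.nrRealPlaces K ≤ 1) : IsOpenMap (phiStar K) := by
  intro O hO
  have hq := (isOpenQuotientMap_integralUnits_quotient hclass hreal).prodMap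
    (IsOpenQuotientMap.id (X := 𝔸ᶠ[K]))
  refine isQuotientMap_quot_mk.isOpen_preimage.1 (hq.isQuotientMap.isOpen_preimage.1 ?_)
  have hc : Continuous fun p : integralUnits K × 𝔸ᶠ[K] ↦
      Quotient.mk (finSetoid K) (((p.1 : (𝔸ᶠ[K])ˣ) : 𝔸ᶠ[K]) * p.2) :=
    continuous_quot_mk.comp (((Units.continuous_val.comp continuous_subtype_val).comp
      continuous_fst).mul continuous_snd)
  convert hO.preimage hc using 1
  ext ⟨r, y⟩
  change Quotient.mk (balancedSetoid K) ((finToIdeles K r : Ideles K ⧸ U K), y) ∈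
    phiStar K '' O ↔ _
  -- The class of (r, y) is φ* of the class of ry, so by injectivity it lies in φ*(O) only if that
  -- class lies in O.
  rw [← phiStar_mk_mul r.2 y, (injective_phiStar K).mem_set_image]
  rfl

end

end AdelicQuotient

theorem mainTheorem7 (K : Type*) [Field K] [NumberField K]
    (hclass : NumberField.classNumber K = 1)
    (hreal : NumberField.InfinitePlace.nrRealPlaces K ≤ 1) :
    IsHomeomorph (AdelicQuotient.phiStar K) :=
  ⟨AdelicQuotient.continuous_phiStar K, AdelicQuotient.isOpenMap_phiStar hclass hreal,
    AdelicQuotient.injective_phiStar K, AdelicQuotient.surjective_phiStar hclass hreal⟩
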